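/- **Conventions.** Two maps $f,g:X\to X$ of a topological space are *group homotopic* (from $f$ to $g$) if there is a continuous $H:X\times[0,1]\to X$ with $H(x,0)=f(x)$, $H(x,1)=g(x)$ for all $x\in X$, and $H(x,t_1+t_2)=H(H(x,t_1),t_2)$ for all $x\in X$ and all $t_1,t_2\in[0,1]$ with $t_1+t_2\in[0,1]$. For a scalar activation function $\mu:\mathbb R\to\mathbb R$ write $\mu:\mathbb R^k\to\mathbb R^k$ also for the map applying $\mu$ to each coordinate. We say that $\mu$ is group homotopic to a homeomorphism onto its image if for some $k\ge 1$ there are a homeomorphism $F:\mathbb R^k\to F(\mathbb R^k)\subset\mathbb R^k$ and a group homotopy from $F$ to $\mu:\mathbb R^k\to\mathbb R^k$. A network $Net^\mu:\mathbb R^n\to\mathbb R^m$ of depth $k\ge1$ is a composition $\mu\circ A_k\circ\mu\circ A_{k-1}\circ\cdots\circ\mu\circ A_1$ with affine maps $A_i:\mathbb R^{n_i}\to\mathbb R^{n_{i+1}}$, $A_i(x)=W_ix+b_i$, $n_1=n$, $n_{k+1}=m$; its width is $\max\{n_1,\dots,n_k\}$. Let $D^n\subset\mathbb R^n$ be the closed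 Euclidean unit ball. **Theorem.** Let $n>1$. For every $\delta>0$ there is a continuous function $f:D^n\to\mathbb R$ such that, for every activation function $\mu$ that is group homotopic to a homeomorphism onto its image and every network $Net^\mu:D^n\to\mathbb R$ of width at most $n$ and of any depth, there is a point $x\in D^n$ with $|Net^\mu(x)-f(x)|\ge\delta$, that is, $\sup_{x\in D^n}|Net^\mu(x)-f(x)|\ge\delta$. Consequently, if for such a $\mu$ the networks $Net^\mu:D^n\to\mathbb R$ of width at most $w$ come uniformly arbitrarily close on $D^n$ to every continuous function $D^n\to\mathbb R$, then $w\ge n+1$. -/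

import Mathlib

/-- Two self-maps `f`, `g` of a topological space are group homotopic, `f` being the initial and `g`
the final map, if there is a (jointly continuous) homotopy `H` from `f` to `g` with
`H(x, s + t) = H(H(x, s), t)` whenever `s`, `t` and `s + t` lie in `[0,1]`. -/
def GroupHomotopic {X : Type*} [TopologicalSpace X] (f g : X → X) : Prop :=
  ∃ H : X × unitInterval → X, Continuous H ∧
    (∀ x, H (x, 0) = f x) ∧ (∀ x, H (x, 1) = g x) ∧
    ∀ (s t r : unitInterval), (r : ℝ) = (s : ℝ) + (t : ℝ) →
      ∀ x, H (x, r) = H (H (x, s), t)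

/-- The coordinatewise map `ℝᵏ → ℝᵏ` induced by a scalar activation function. -/
def coordwise (μ : ℝ → ℝ) (k : ℕ) (x : Fin k → ℝ) : Fin k → ℝ := fun i => μ (x i)

/-- The scalar activation function `μ` induces, in some dimension `k ≥ 1`, a coordinatewise map
`ℝᵏ → ℝᵏ` that is group homotopic to a homeomorphism `F` of `ℝᵏ` onto its image `F(ℝᵏ) ⊆ ℝᵏ`;
the homotopy starts at `F` and ends at the activation map. -/
def IsGroupHomotopicToHomeo (μ : ℝ → ℝ) : Prop :=
  ∃ k : ℕ, 1 ≤ k ∧ ∃ F : (Fin k → ℝ) → (Fin k → ℝ),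
    Topology.IsEmbedding F ∧ GroupHomotopic F (coordwise μ k)

/-- The parameters (weight matrices and bias vectors) of a network from `ℝⁿ` to `ℝᵐ`, listed from
the first layer to the last: one layer, or a first layer `ℝⁿ → ℝᵖ` followed by a network
from `ℝᵖ` to `ℝᵐ`. The depth, the number of layers, is at least one and otherwise arbitrary. -/
inductive DNN : ℕ → ℕ → Type
  | last {n m : ℕ} (W : Matrix (Fin m) (Fin n) ℝ) (b : Fin m → ℝ) : DNN n m
  | cons {n p m : ℕ} (W : Matrix (Fin p) (Fin n) ℝ) (b : Fin p → ℝ) (N : DNN p m) : DNN n m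

/-- One layer map `x ↦ μ(W x + b)`, with `μ` applied coordinatewise. -/
def layerMap (μ : ℝ → ℝ) {n m : ℕ} (W : Matrix (Fin m) (Fin n) ℝ) (b : Fin m → ℝ)
    (x : Fin n → ℝ) : Fin m → ℝ :=
  coordwise μ m (W.mulVec x + b)

/-- The map `μ ∘ A_k ∘ ⋯ ∘ μ ∘ A_1` computed by a network with activation function `μ`. -/
def DNN.eval (μ : ℝ → ℝ) : {n m : ℕ} → DNN n m → (Fin n → ℝ) → (Fin m → ℝ)
  | _, _, .last W b, x => layerMap μ W b x
  | _, _, .cons W b N, x => N.eval μ (layerMap μ W b x)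

/-- The width: the maximum of the dimensions `n_1, …, n_k` of the domains of the layer maps
(the input dimension and the dimensions of the hidden layers). -/
def DNN.width : {n m : ℕ} → DNN n m → ℕ
  | n, _, .last _ _ => n
  | n, _, .cons _ _ N => max n N.width

/-- The standard closed unit ball of Euclidean `n`-space. -/
abbrev unitBall (n : ℕ) : Set (EuclideanSpace ℝ (Fin n)) := Metric.closedBall 0 1

/-- The real-valued function on the unit ball given by a network with one-dimensional output. -/
def DNN.onBall (μ : ℝ → ℝ) {n : ℕ} (N : DNN n 1) (x : unitBall n) : ℝ :=
  N.eval μ x.1.ofLp 0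

/-- Networks of width at most `w` with activation `μ` are universal approximators on the unit ball
of `ℝⁿ`: they come uniformly arbitrarily close to each continuous real function. -/
def UniversalApproximation (μ : ℝ → ℝ) (n w : ℕ) : Prop :=
  ∀ f : C(unitBall n, ℝ), ∀ ε : ℝ, 0 < ε →
    ∃ N : DNN n 1, N.width ≤ w ∧ ∀ x : unitBall n, |N.onBall μ x - f x| < ε

/-! A group homotopy starts at an injective idempotent map, hence at the identity, so the
coordinatewise `μ` is the time-one map of a semiflow on `[0,1]`. Orbits that meet stay together; by
homotopy invariance, which rests on Brouwer's theorem, a fibre of the time-one map cannot have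
points both inside and outside a bounded open set while missing its frontier. If `μ` were not
monotone, a cube would separate a fibre in this way. So `μ` is continuous and monotone or antitone
(`monotone_or_antitone`).

Adding small multiples of the identity to the linear parts, and small linear terms to `μ`, turns a
padded network of width at most `n` into homeomorphisms of `ℝⁿ` converging to it. A coordinate of a
homeomorphism takes its value at `0` again on the unit sphere, and compactness passes this to the
limit. No such network can therefore follow a function whose value at the centre is far from its
values on the sphere. -/

open MeasureTheory Filter Topology

/-! ### Families polynomial in a parameter, and their integrals -/

/-- A family `t ↦ h t` of real functions that is a polynomial in `t` with continuous functions as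
coefficients. -/
def IsPolynomialFamily {X : Type*} [TopologicalSpace X] (h : ℝ → X → ℝ) : Prop :=
  ∃ P : Polynomial C(X, ℝ), ∀ t x, h t x = P.eval (ContinuousMap.const X t) x

namespace IsPolynomialFamily

variable {X : Type*} [TopologicalSpace X] {h₁ h₂ : ℝ → X → ℝ}

theorem add (H₁ : IsPolynomialFamily h₁) (H₂ : IsPolynomialFamily h₂) :
    IsPolynomialFamily (fun t x => h₁ t x + h₂ t x) := by
  obtain ⟨P, hP⟩ := H₁
  obtain ⟨Q, hQ⟩ := H₂
  exact ⟨P + Q, fun t x => by simp [hP, hQ]⟩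

theorem mul (H₁ : IsPolynomialFamily h₁) (H₂ : IsPolynomialFamily h₂) :
    IsPolynomialFamily (fun t x => h₁ t x * h₂ t x) := by
  obtain ⟨P, hP⟩ := H₁
  obtain ⟨Q, hQ⟩ := H₂
  exact ⟨P * Q, fun t x => by simp [hP, hQ]⟩

theorem of_continuous {c : X → ℝ} (hc : Continuous c) :
    IsPolynomialFamily (fun _ x => c x) :=
  ⟨Polynomial.C ⟨c, hc⟩, fun t x => by simp⟩

theorem param : IsPolynomialFamily (fun t (_ : X) => t) :=
  ⟨Polynomial.X, fun t x => by simp⟩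

theorem affine {c d : X → ℝ} (hc : Continuous c) (hd : Continuous d) :
    IsPolynomialFamily (fun t x => c x + t * d x) :=
  (of_continuous hc).add (param.mul (of_continuous hd))

theorem pow (H₁ : IsPolynomialFamily h₁) (m : ℕ) :
    IsPolynomialFamily (fun t x => h₁ t x ^ m) := by
  obtain ⟨P, hP⟩ := H₁
  exact ⟨P ^ m, fun t x => by simp [hP]⟩

theorem sum {ι : Type*} (s : Finset ι) {h : ι → ℝ → X → ℝ}
    (H : ∀ i, IsPolynomialFamily (h i)) :
    IsPolynomialFamily (fun t x => ∑ i ∈ s, h i t x) := by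
  choose P hP using H
  exact ⟨∑ i ∈ s, P i, fun t x => by simp [hP, Polynomial.eval_finsetSum]⟩

theorem prod {ι : Type*} (s : Finset ι) {h : ι → ℝ → X → ℝ}
    (H : ∀ i, IsPolynomialFamily (h i)) :
    IsPolynomialFamily (fun t x => ∏ i ∈ s, h i t x) := by
  choose P hP using H
  exact ⟨∏ i ∈ s, P i, fun t x => by simp [hP, Polynomial.eval_prod]⟩

theorem det {ι : Type*} [Fintype ι] [DecidableEq ι] {A : ℝ → X → Matrix ι ι ℝ}
    (H : ∀ i j, IsPolynomialFamily (fun t x => A t x i j)) :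
    IsPolynomialFamily (fun t x => (A t x).det) := by
  simp only [Matrix.det_apply']
  exact sum _ fun σ => (of_continuous continuous_const).mul (prod _ fun i => H _ _)

theorem exists_eval_eq_integral [MeasurableSpace X] [OpensMeasurableSpace X] {ν : Measure X}
    [IsFiniteMeasureOnCompacts ν] [T2Space X]
    {K : Set X} (hK : IsCompact K) (H₁ : IsPolynomialFamily h₁) :
    ∃ Q : Polynomial ℝ, ∀ t, ∫ x in K, h₁ t x ∂ν = Q.eval t := by
  obtain ⟨P, hP⟩ := H₁
  refine ⟨∑ i ∈ Finset.range (P.natDegree + 1),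
    Polynomial.C (∫ x in K, P.coeff i x ∂ν) * Polynomial.X ^ i, fun t => ?_⟩
  have hsum : ∀ x, h₁ t x = ∑ i ∈ Finset.range (P.natDegree + 1), P.coeff i x * t ^ i := fun x => by
    simp [hP, Polynomial.eval_eq_sum_range]
  simp only [hsum]
  rw [integral_finsetSum, Polynomial.eval_finsetSum]
  · exact Finset.sum_congr rfl fun i _ => by simp [integral_mul_const]
  · intro i _
    exact ((P.coeff i).continuous.mul continuous_const).continuousOn.integrableOn_compact hK

end IsPolynomialFamily

/-! ### Brouwer's theorem by change of variables -/

section Perturbation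

variable {E : Type*} [NormedAddCommGroup E]

theorem bijective_id_add_of_lipschitz [CompleteSpace E] {v : E → E} {K : NNReal} (hK : K < 1)
    (hv : LipschitzWith K v) : Function.Bijective (fun x => x + v x) := by
  constructor
  · intro x y hxy
    by_contra hne
    have h1 : dist x y ≤ K * dist x y := by
      calc dist x y = dist (v x) (v y) := by
            simp only [dist_eq_norm]
            have : x - y = -(v x - v y) := by
              have : x + v x = y + v y := hxy
              rw [neg_sub, sub_eq_sub_iff_add_eq_add, this, add_comm]
            rw [this, norm_neg]
        _ ≤ K * dist x y := hv.dist_le_mul x y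
    have h2 : 0 < dist x y := dist_pos.2 hne
    have h3 : (K : ℝ) < 1 := hK
    nlinarith
  · intro y
    have hc : ContractingWith K (fun x => y - v x) := by
      refine ⟨hK, LipschitzWith.of_dist_le_mul fun a b => ?_⟩
      rw [dist_sub_left]
      exact hv.dist_le_mul a b
    have := hc.fixedPoint_isFixedPt
    refine ⟨hc.fixedPoint _, ?_⟩
    have h : y - v (hc.fixedPoint _) = hc.fixedPoint _ := this
    exact eq_sub_iff_add_eq.1 h.symm

end Perturbation

section Brouwer

variable {ι : Type*} [Fintype ι]

theorem isPolynomialFamily_det_fderiv {u : (ι → ℝ) → (ι → ℝ)} (hu : ContDiff ℝ 1 u) :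
    IsPolynomialFamily
      (fun t x => (ContinuousLinearMap.id ℝ (ι → ℝ) + t • fderiv ℝ u x).det) := by
  classical
  have hd : Continuous (fderiv ℝ u) := hu.continuous_fderiv one_ne_zero
  have : ∀ (t : ℝ) x, (ContinuousLinearMap.id ℝ (ι → ℝ) + t • fderiv ℝ u x).det
      = (LinearMap.toMatrix'
        (ContinuousLinearMap.id ℝ (ι → ℝ) + t • fderiv ℝ u x).toLinearMap).det := by
    intro t x
    rw [LinearMap.det_toMatrix']
  simp only [this]
  refine IsPolynomialFamily.det fun i j => ?_
  simp only [LinearMap.toMatrix'_apply]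
  exact IsPolynomialFamily.affine (c := fun _ => (Pi.single j 1 : ι → ℝ) i)
    (d := fun x => fderiv ℝ u x (Pi.single j 1) i) continuous_const
    ((continuous_apply i).comp (hd.clm_apply continuous_const))

/-- Change of variables of degree one: a compactly supported perturbation of the identity
preserves the integral of a polynomial, counted with the signed Jacobian determinant. -/
theorem integral_comp_id_add_mul_det {u : (ι → ℝ) → (ι → ℝ)} (hu : ContDiff ℝ 1 u)
    (hc : HasCompactSupport u) {K : Set (ι → ℝ)} (hK : IsCompact K) (huK : ∀ x, x ∉ K → u x = 0)
    {p : (ι → ℝ) → ℝ} (hp : IsPolynomialFamily (fun t x => p (x + t • u x))) :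
    ∫ x in K, (ContinuousLinearMap.id ℝ (ι → ℝ) + fderiv ℝ u x).det * p (x + u x)
      = ∫ x in K, p x := by
  -- With `t • u` in place of `u` the integral is a polynomial in `t`. It is constant near `0`,
  -- where the map is a bijection of `K` with positive Jacobian, and hence constant up to `t = 1`.
  obtain ⟨Q, hQ⟩ := ((isPolynomialFamily_det_fderiv hu).mul hp).exists_eval_eq_integral
    (ν := volume) hK
  obtain ⟨C, hC⟩ := hu.lipschitzWith_of_hasCompactSupport hc one_ne_zero
  have hd : Continuous (fderiv ℝ u) := hu.continuous_fderiv one_ne_zero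
  have hpos : ∀ᶠ t : ℝ in 𝓝 0, ∀ x ∈ K,
      0 < (ContinuousLinearMap.id ℝ (ι → ℝ) + t • fderiv ℝ u x).det := by
    refine hK.eventually_forall_of_forall_eventually fun x _ => ?_
    have hcont : Continuous fun z : ℝ × (ι → ℝ) =>
        (ContinuousLinearMap.id ℝ (ι → ℝ) + z.1 • fderiv ℝ u z.2).det :=
      ContinuousLinearMap.continuous_det.comp
        (continuous_const.add (continuous_fst.smul (hd.comp continuous_snd)))
    refine hcont.continuousAt.eventually_const_lt ?_
    simp [ContinuousLinearMap.det]
  have hsmall : ∀ᶠ t : ℝ in 𝓝 0, ‖t‖₊ * C < 1 := by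
    have hcont : Continuous fun t : ℝ => ‖t‖₊ * C := by fun_prop
    exact hcont.continuousAt.eventually_lt_const (by simp)
  have hev : ∀ᶠ t : ℝ in 𝓝 0, Q.eval t = ∫ x in K, p x := by
    filter_upwards [hpos, hsmall] with t ht1 ht2
    have hbij : Function.Bijective (fun x => x + t • u x) :=
      bijective_id_add_of_lipschitz ht2 (v := fun x => t • u x) (by
        refine LipschitzWith.of_dist_le_mul fun a b => ?_
        rw [dist_smul₀, NNReal.coe_mul, mul_assoc]
        exact mul_le_mul_of_nonneg_left (hC.dist_le_mul a b) (norm_nonneg t))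
    have himg : (fun x => x + t • u x) '' K = K := by
      have h1 : (fun x => x + t • u x) '' Kᶜ = Kᶜ := by
        have : Set.EqOn (fun x => x + t • u x) id Kᶜ := fun x hx => by simp [huK x hx]
        rw [this.image_eq, Set.image_id]
      have h2 := Set.image_compl_eq (s := K) hbij
      rw [h1] at h2
      exact (compl_injective h2).symm
    rw [← hQ t]
    have hcv := integral_image_eq_integral_abs_det_fderiv_smul (volume : Measure (ι → ℝ))
      hK.measurableSet (f := fun x => x + t • u x)
      (f' := fun x => ContinuousLinearMap.id ℝ (ι → ℝ) + t • fderiv ℝ u x)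
      (fun x _ => ((hasFDerivAt_id x).add
        (((hu.differentiable one_ne_zero x).hasFDerivAt).const_smul t)).hasFDerivWithinAt)
      hbij.1.injOn p
    rw [himg] at hcv
    rw [hcv]
    refine setIntegral_congr_fun hK.measurableSet fun x hx => ?_
    simp only [smul_eq_mul, abs_of_pos (ht1 x hx)]
  have hQc : Q = Polynomial.C (∫ x in K, p x) := by
    refine Polynomial.eq_of_infinite_eval_eq _ _ ?_
    refine infinite_of_mem_nhds (0 : ℝ) ?_
    filter_upwards [hev] with t ht
    simpa using ht
  have := hQ 1
  rw [hQc] at this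
  simpa using this

theorem exists_const_mul_pow_lt {a b c D : ℝ} (ha : 0 ≤ a) (hab : a < b) (hc : 0 < c) :
    ∃ m : ℕ, D * a ^ m < c * b ^ m := by
  have hb : 0 < b := ha.trans_lt hab
  have hD : 0 < |D| + 1 := by positivity
  obtain ⟨m, hm⟩ := exists_pow_lt_of_lt_one (div_pos hc hD) ((div_lt_one hb).2 hab)
  refine ⟨m, ?_⟩
  rw [div_pow, div_lt_div_iff₀ (pow_pos hb m) hD] at hm
  calc D * a ^ m ≤ (|D| + 1) * a ^ m :=
        mul_le_mul_of_nonneg_right (by linarith [le_abs_self D]) (pow_nonneg ha m)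
    _ < c * b ^ m := by linarith

/-- Without a zero, `q (x + u x) ≥ η > 0` on `K`. The test polynomial `(1 - q / S) ^ m` peaks at the
origin, so for large `m` its integral over `K` exceeds the integral pulled back along `x + u x`,
although degree one makes them equal. -/
theorem exists_id_add_eq_zero_of_contDiff {u : (ι → ℝ) → (ι → ℝ)} (hu : ContDiff ℝ 1 u)
    (hc : HasCompactSupport u) : ∃ x, x + u x = 0 := by
  by_contra! hne
  obtain ⟨R, hR0, hR⟩ := hc.isCompact.isBounded.subset_closedBall_lt 0 0
  set K : Set (ι → ℝ) := Metric.closedBall 0 R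
  have hK : IsCompact K := isCompact_closedBall _ _
  have huK : ∀ x, x ∉ K → u x = 0 := fun x hx =>
    image_eq_zero_of_notMem_tsupport fun h => hx (hR h)
  have h0K : (0 : ι → ℝ) ∈ K := Metric.mem_closedBall_self hR0.le
  let q : (ι → ℝ) → ℝ := fun y => ∑ i, y i ^ 2
  have hq : Continuous q := by fun_prop
  have hqpos : ∀ y, y ≠ 0 → 0 < q y := by
    intro y hy
    obtain ⟨i, hi⟩ := Function.ne_iff.1 hy
    exact Finset.sum_pos' (fun j _ => sq_nonneg _) ⟨i, Finset.mem_univ i, by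
      have : y i ≠ 0 := hi
      positivity⟩
  have hφ : Continuous fun x => x + u x := continuous_id.add hu.continuous
  obtain ⟨x₀, -, hx₀⟩ := hK.exists_isMinOn ⟨0, h0K⟩ (hq.comp hφ).continuousOn
  obtain ⟨x₁, -, hx₁⟩ := hK.exists_isMaxOn ⟨0, h0K⟩ (hq.comp hφ).continuousOn
  obtain ⟨x₂, -, hx₂⟩ := hK.exists_isMaxOn ⟨0, h0K⟩ hq.continuousOn
  set η : ℝ := q (x₀ + u x₀)
  have hη : 0 < η := hqpos _ (hne _)
  have hη' : ∀ x ∈ K, η ≤ q (x + u x) := fun x hx => hx₀ hx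
  -- `S` bounds `q` on both `K` and its image, so that `1 - q / S` is nonnegative on each.
  obtain ⟨S, hS1, hS2⟩ : ∃ S, (∀ x ∈ K, q (x + u x) ≤ S) ∧ ∀ x ∈ K, q x ≤ S :=
    ⟨max (q (x₁ + u x₁)) (q x₂), fun x hx => (hx₁ hx).trans (le_max_left _ _),
      fun x hx => (hx₂ hx).trans (le_max_right _ _)⟩
  have hηS : η ≤ S := (hη' 0 h0K).trans (hS1 0 h0K)
  have hS : 0 < S := hη.trans_le hηS
  let V : Set (ι → ℝ) := Metric.ball 0 R ∩ {y | q y < η / 2}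
  have hVo : IsOpen V := Metric.isOpen_ball.inter (isOpen_lt hq continuous_const)
  have hV0 : (0 : ι → ℝ) ∈ V := ⟨Metric.mem_ball_self hR0, by simp [q, hη]⟩
  have hVK : V ⊆ K := fun y hy => Metric.ball_subset_closedBall hy.1
  have hVfin : volume V ≠ ⊤ := ((measure_mono hVK).trans_lt hK.measure_lt_top).ne
  have hVpos : 0 < volume.real V := ENNReal.toReal_pos (hVo.measure_pos _ ⟨0, hV0⟩).ne' hVfin
  let J : (ι → ℝ) → ℝ := fun x => (ContinuousLinearMap.id ℝ (ι → ℝ) + fderiv ℝ u x).det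
  have hJ : Continuous J := ContinuousLinearMap.continuous_det.comp
    (continuous_const.add (hu.continuous_fderiv one_ne_zero))
  obtain ⟨m, hm⟩ := exists_const_mul_pow_lt (a := 1 - η / S) (b := 1 - η / 2 / S)
    (c := volume.real V) (D := ∫ x in K, |J x|)
    (by rw [sub_nonneg, div_le_one hS]; exact hηS)
    (by gcongr; linarith) hVpos
  let p : (ι → ℝ) → ℝ := fun y => (1 - q y / S) ^ m
  have hpc : Continuous p := (continuous_const.sub (hq.div_const S)).pow m
  have hp : IsPolynomialFamily (fun t x => p (x + t • u x)) := by
    have : ∀ (t : ℝ) x, p (x + t • u x)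
        = (1 + (-1 / S) * ∑ i, (x i + t * u x i) ^ 2) ^ m := by
      intro t x
      simp only [p, q, Pi.add_apply, Pi.smul_apply, smul_eq_mul]
      congr 1
      ring
    simp only [this]
    refine IsPolynomialFamily.pow (.add (.of_continuous continuous_const)
      (.mul (.of_continuous continuous_const) (.sum _ fun i => .pow (.affine ?_ ?_) 2))) m
    · exact continuous_apply i
    · exact (continuous_apply i).comp hu.continuous
  have hint := integral_comp_id_add_mul_det hu hc hK huK hp
  have hp_nonneg : ∀ x ∈ K, 0 ≤ p x := fun x hx =>
    pow_nonneg (by rw [sub_nonneg, div_le_one hS]; exact hS2 x hx) m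
  have hpi : IntegrableOn p K := hpc.continuousOn.integrableOn_compact hK
  have hlow : volume.real V * (1 - η / 2 / S) ^ m ≤ ∫ x in K, p x := by
    calc volume.real V * (1 - η / 2 / S) ^ m = ∫ x in V, (1 - η / 2 / S) ^ m := by
          rw [setIntegral_const, smul_eq_mul]
      _ ≤ ∫ x in V, p x := by
          refine setIntegral_mono_on (integrableOn_const hVfin) (hpi.mono_set hVK)
            hVo.measurableSet fun x hx => ?_
          refine pow_le_pow_left₀ ?_ ?_ m
          · rw [sub_nonneg, div_le_one hS]; linarith
          · have : q x < η / 2 := hx.2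
            gcongr
      _ ≤ ∫ x in K, p x := by
          refine setIntegral_mono_set hpi ?_ (Eventually.of_forall hVK)
          exact (ae_restrict_mem hK.measurableSet).mono fun x hx => hp_nonneg x hx
  have hup : ∫ x in K, J x * p (x + u x) ≤ (∫ x in K, |J x|) * (1 - η / S) ^ m := by
    rw [← integral_mul_const]
    refine setIntegral_mono_on ((hJ.mul (hpc.comp hφ)).continuousOn.integrableOn_compact hK)
      ((hJ.abs.mul continuous_const).continuousOn.integrableOn_compact hK)
      hK.measurableSet fun x hx => ?_
    have hb : 0 ≤ 1 - q (x + u x) / S := by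
      rw [sub_nonneg, div_le_one hS]; exact hS1 x hx
    have hb' : 1 - q (x + u x) / S ≤ 1 - η / S := by
      have := hη' x hx
      gcongr
    calc J x * p (x + u x) ≤ |J x| * p (x + u x) :=
          mul_le_mul_of_nonneg_right (le_abs_self _) (pow_nonneg hb m)
      _ ≤ |J x| * (1 - η / S) ^ m :=
          mul_le_mul_of_nonneg_left (pow_le_pow_left₀ hb hb' m) (abs_nonneg _)
  linarith [hint.symm.le.trans hup]

/-- **Brouwer's theorem** for compactly supported perturbations of the identity. -/
theorem exists_id_add_eq_zero {u : (ι → ℝ) → (ι → ℝ)} (hu : Continuous u)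
    (hc : HasCompactSupport u) : ∃ x, x + u x = 0 := by
  by_contra! hne
  -- The error allowed at `x` is `‖x + u x‖` itself: a zero of `x + g x` would make the error equal
  -- to it, but the approximation is strict.
  obtain ⟨g, hg, hgu, -, hgs⟩ := hu.exists_contDiff_approx_and_eqOn 1
    (ε := fun x => ‖x + u x‖) (continuous_id.add hu).norm (fun x => norm_pos_iff.2 (hne x))
    (S := ∅) (U := ∅) isClosed_empty (by simp) contDiffOn_empty
  obtain ⟨x, hx⟩ := exists_id_add_eq_zero_of_contDiff hg (hc.mono hgs)
  have := hgu x
  rw [dist_eq_norm, eq_neg_of_add_eq_zero_right hx, ← neg_add', norm_neg] at this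
  exact lt_irrefl _ this

end Brouwer

/-! ### Fibres of semiflows -/

section Semiflow

variable {ι : Type*} [Fintype ι]

/-- Homotopy invariance: a homotopy from `z ↦ z - x`, `x ∈ Ω`, without zeros on the frontier of
the bounded open set `Ω` ends at a map with a zero in `Ω`. -/
theorem exists_zero_of_homotopy {Ω : Set (ι → ℝ)} (hΩ : IsOpen Ω) (hb : Bornology.IsBounded Ω)
    {x : ι → ℝ} (hx : x ∈ Ω) {h : (ι → ℝ) × unitInterval → (ι → ℝ)} (hh : Continuous h)
    (h0 : ∀ z, h (z, 0) = z - x) (hfr : ∀ z ∈ frontier Ω, ∀ t, h (z, t) ≠ 0) :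
    ∃ z ∈ Ω, h (z, 1) = 0 := by
  let A : Set (ι → ℝ) := Prod.fst '' ((closure Ω ×ˢ Set.univ) ∩ h ⁻¹' {0})
  have hA : IsCompact A :=
    ((hb.isCompact_closure.prod isCompact_univ).inter_right
      (isClosed_singleton.preimage hh)).image continuous_fst
  have hAΩ : A ⊆ Ω := by
    rintro _ ⟨⟨z, t⟩, ⟨⟨hz, -⟩, hzt⟩, rfl⟩
    by_contra hn
    exact hfr z ⟨hz, by rwa [hΩ.interior_eq]⟩ t hzt
  -- A Urysohn function serves as the time: `0` off `Ω`, `1` at every point of `Ω` where some stage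
  -- of the homotopy vanishes. A zero of `h (z, l z)` is then a zero at time one.
  obtain ⟨l, hl0, hl1, hl⟩ := exists_continuous_zero_one_of_isClosed hΩ.isClosed_compl
    hA.isClosed (Set.disjoint_left.2 fun z hz hzA => hz (hAΩ hzA))
  let τ : (ι → ℝ) → unitInterval := fun z => ⟨l z, hl z⟩
  have hτ : Continuous τ := by fun_prop
  let u : (ι → ℝ) → (ι → ℝ) := fun z => h (z, τ z) + x - z
  -- Recentring at `x` gives `z + v z = h (z + x, τ (z + x))`, and `v z` vanishes when `z + x ∉ Ω`.
  let v : (ι → ℝ) → (ι → ℝ) := fun z => h (z + x, τ (z + x)) - z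
  have hv : Continuous v := by fun_prop
  have hout : ∀ z, z ∉ Ω → τ z = 0 := fun z hz => Subtype.ext (hl0 hz)
  have hvc : HasCompactSupport v := by
    refine HasCompactSupport.intro (K := (fun z => z - x) '' closure Ω)
      (hb.isCompact_closure.image (by fun_prop)) fun z hz => ?_
    have : z + x ∉ Ω := fun hzx => hz ⟨z + x, subset_closure hzx, by simp⟩
    simp [v, hout _ this, h0]
  obtain ⟨z, hz⟩ := exists_id_add_eq_zero hv hvc
  have hz' : h (z + x, τ (z + x)) = 0 := by simpa [v] using hz
  have hzΩ : z + x ∈ Ω := by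
    by_contra hn
    rw [hout _ hn, h0, add_sub_cancel_right] at hz'
    rw [hz', zero_add] at hn
    exact hn hx
  refine ⟨z + x, hzΩ, ?_⟩
  have hzA : z + x ∈ A := ⟨(z + x, τ (z + x)), ⟨⟨subset_closure hzΩ, trivial⟩, hz'⟩, rfl⟩
  have : τ (z + x) = 1 := Subtype.ext (hl1 hzA)
  rwa [this] at hz'

/-- The fibres of the time-one map of a semiflow cannot be separated by a bounded open set. -/
theorem exists_mem_frontier_of_semiflow {H : (ι → ℝ) × unitInterval → (ι → ℝ)}
    (hH : Continuous H) (h0 : ∀ x, H (x, 0) = x)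
    (hadd : ∀ s t r : unitInterval, (r : ℝ) = s + t → ∀ x, H (x, r) = H (H (x, s), t))
    {Ω : Set (ι → ℝ)} (hΩ : IsOpen Ω) (hb : Bornology.IsBounded Ω) {x y : ι → ℝ}
    (hx : x ∈ Ω) (hy : y ∉ Ω) (hxy : H (x, 1) = H (y, 1)) :
    ∃ z ∈ frontier Ω, H (z, 1) = H (x, 1) := by
  by_contra! hne
  have hmerge : ∀ z w s, H (z, s) = H (w, s) → H (z, 1) = H (w, 1) := by
    intro z w s hs
    have h1 : ((1 : unitInterval) : ℝ) = s + (unitInterval.symm s : unitInterval) := by simp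
    rw [hadd _ _ _ h1, hadd _ _ _ h1, hs]
  let γ : ∀ w, Path ((0 : unitInterval), w) (1, H (w, 1)) := fun w =>
    { toFun := fun t => (t, H (w, t))
      continuous_toFun := by fun_prop
      source' := by simp [h0]
      target' := rfl }
  -- The path of pairs (time, target) follows the orbit of `x` up to time one and returns along the
  -- orbit of `y`. It yields a homotopy from `z - x` to `z - y`, whose zeros on the frontier are
  -- excluded by `hmerge`.
  let δ : Path ((0 : unitInterval), x) (0, y) := (γ x).trans ((γ y).symm.cast (by rw [hxy]) rfl)
  have hδ : ∀ t, (δ t).2 = H (x, (δ t).1) ∨ (δ t).2 = H (y, (δ t).1) := by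
    intro t
    have : δ t ∈ Set.range δ := ⟨t, rfl⟩
    rw [Path.trans_range] at this
    rcases this with ⟨s, hs⟩ | ⟨s, hs⟩
    · left; rw [← hs]; rfl
    · right; rw [← hs]; rfl
  obtain ⟨z, hz, hz0⟩ := exists_zero_of_homotopy hΩ hb hx
    (h := fun z => H (z.1, (δ z.2).1) - (δ z.2).2) (by fun_prop)
    (fun z => by simp [h0]) (fun z hz t ht => by
      have ht' := sub_eq_zero.1 ht
      rcases hδ t with h | h <;> rw [h] at ht'
      · exact hne z hz (hmerge _ _ _ ht')
      · exact hne z hz ((hmerge _ _ _ ht').trans hxy.symm))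
  have : z = y := by simpa [h0, sub_eq_zero] using hz0
  exact hy (this ▸ hz)

end Semiflow

/-! ### Monotonicity of the activation function -/

theorem exists_eq_endpoint_of_mem_frontier_pi_Ioo {ι : Type*} [Finite ι] {a b : ℝ} {z : ι → ℝ}
    (hz : z ∈ frontier (Set.univ.pi fun _ : ι => Set.Ioo a b)) : ∃ i, z i = a ∨ z i = b := by
  have ho : IsOpen (Set.univ.pi fun _ : ι => Set.Ioo a b) :=
    isOpen_set_pi Set.finite_univ fun _ _ => isOpen_Ioo
  rw [ho.frontier_eq] at hz
  have hc : z ∈ Set.univ.pi fun _ : ι => Set.Icc a b :=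
    closure_minimal (Set.pi_mono fun _ _ => Set.Ioo_subset_Icc_self)
      (isClosed_set_pi fun _ _ => isClosed_Icc) hz.1
  by_contra! hn
  exact hz.2 fun i hi => ⟨lt_of_le_of_ne (hc i hi).1 (hn i).1.symm,
    lt_of_le_of_ne (hc i hi).2 (hn i).2⟩

namespace IsGroupHomotopicToHomeo

variable {μ : ℝ → ℝ}

/-- The initial map of the group homotopy is injective and idempotent, hence the identity. -/
theorem exists_semiflow (h : IsGroupHomotopicToHomeo μ) :
    ∃ k : ℕ, 1 ≤ k ∧ ∃ H : (Fin k → ℝ) × unitInterval → (Fin k → ℝ), Continuous H ∧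
      (∀ x, H (x, 0) = x) ∧ (∀ x, H (x, 1) = coordwise μ k x) ∧
      ∀ s t r : unitInterval, (r : ℝ) = s + t → ∀ x, H (x, r) = H (H (x, s), t) := by
  obtain ⟨k, hk, F, hF, H, hH, h0, h1, hadd⟩ := h
  refine ⟨k, hk, H, hH, fun x => ?_, h1, hadd⟩
  have := hadd 0 0 0 (by simp) x
  rw [h0, h0] at this
  rw [h0]
  exact (hF.injective this).symm

theorem continuous (h : IsGroupHomotopicToHomeo μ) : Continuous μ := by
  obtain ⟨k, hk, H, hH, -, h1, -⟩ := h.exists_semiflow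
  have : μ = fun s => H (fun _ => s, 1) ⟨0, hk⟩ := by
    funext s
    rw [h1]
    rfl
  rw [this]
  fun_prop

theorem monotone_or_antitone (h : IsGroupHomotopicToHomeo μ) : Monotone μ ∨ Antitone μ := by
  have hμ := h.continuous
  obtain ⟨k, hk, H, hH, h0, h1, hadd⟩ := h.exists_semiflow
  by_contra! hn
  -- A value `v` taken inside `(a, b)` and again on `[b, c]`, but not at `a` or `b`, gives two
  -- diagonal points of one fibre, separated by the cube `(a, b)ᵏ`. A frontier point of the cube has
  -- a coordinate `a` or `b`, where `μ` is not `v`.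
  have key : ∀ a b c v : ℝ, a < b → b < c → v ≠ μ a → v ≠ μ b →
      v ∈ Set.uIcc (μ a) (μ b) → v ∈ Set.uIcc (μ b) (μ c) → False := by
    intro a b c v hab hbc hva hvb h₁ h₂
    obtain ⟨s, hs, hsv⟩ := intermediate_value_uIcc hμ.continuousOn h₁
    obtain ⟨s', hs', hsv'⟩ := intermediate_value_uIcc hμ.continuousOn h₂
    rw [Set.uIcc_of_le hab.le] at hs
    rw [Set.uIcc_of_le hbc.le] at hs'
    have hsa : a < s := lt_of_le_of_ne hs.1 fun e => hva (by rw [e, hsv])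
    have hsb : s < b := lt_of_le_of_ne hs.2 fun e => hvb (by rw [← e, hsv])
    obtain ⟨z, hz, hzv⟩ := exists_mem_frontier_of_semiflow hH h0 hadd
      (Ω := Set.univ.pi fun _ => Set.Ioo a b)
      (isOpen_set_pi Set.finite_univ fun _ _ => isOpen_Ioo)
      (Bornology.IsBounded.pi fun _ => Metric.isBounded_Ioo a b)
      (x := fun _ => s) (y := fun _ => s') (fun _ _ => ⟨hsa, hsb⟩)
      (fun hmem => not_lt.2 hs'.1 (hmem ⟨0, hk⟩ trivial).2)
      (by rw [h1, h1]; funext i; simp [coordwise, hsv, hsv'])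
    obtain ⟨i, hi⟩ := exists_eq_endpoint_of_mem_frontier_pi_Ioo hz
    rw [h1, h1] at hzv
    have hzi : μ (z i) = v := (congrFun hzv i).trans hsv
    rcases hi with hi | hi <;> rw [hi] at hzi
    · exact hva hzi.symm
    · exact hvb hzi.symm
  obtain ⟨a, b, c, hab, hbc, ⟨h₁, h₂⟩ | ⟨h₁, h₂⟩⟩ :=
    not_monotone_not_antitone_iff_exists_lt_lt.1 hn
  · obtain ⟨v, hv, hvb⟩ := exists_between (max_lt h₁ h₂)
    obtain ⟨hva, hvc⟩ := max_lt_iff.1 hv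
    exact key a b c v hab hbc hva.ne' hvb.ne
      (Set.mem_uIcc.2 (.inl ⟨hva.le, hvb.le⟩)) (Set.mem_uIcc.2 (.inr ⟨hvc.le, hvb.le⟩))
  · obtain ⟨v, hvb, hv⟩ := exists_between (lt_min h₁ h₂)
    obtain ⟨hva, hvc⟩ := lt_min_iff.1 hv
    exact key a b c v hab hbc hva.ne hvb.ne'
      (Set.mem_uIcc.2 (.inr ⟨hvb.le, hva.le⟩)) (Set.mem_uIcc.2 (.inl ⟨hvb.le, hvc.le⟩))

end IsGroupHomotopicToHomeo

/-! ### Networks as limits of homeomorphisms -/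

theorem exists_homeomorph_add_mul_of_monotone {μ : ℝ → ℝ} (hμ : Continuous μ) (hm : Monotone μ)
    {ε : ℝ} (hε : 0 < ε) : ∃ e : ℝ ≃ₜ ℝ, ∀ x, e x = μ x + ε * x := by
  have hc : Continuous fun x => μ x + ε * x := by fun_prop
  have hs : StrictMono fun x => μ x + ε * x :=
    hm.add_strictMono (strictMono_mul_left_of_pos hε)
  have hsurj : Function.Surjective fun x => μ x + ε * x := by
    refine hc.surjective ?_ ?_
    · refine tendsto_atTop_mono' _ ?_
        (tendsto_atTop_add_const_left _ (μ 0) (tendsto_id.const_mul_atTop hε))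
      filter_upwards [eventually_ge_atTop 0] with x hx
      exact add_le_add_left (hm hx) _
    · refine tendsto_atBot_mono' _ ?_
        (tendsto_atBot_add_const_left _ (μ 0) (tendsto_id.const_mul_atBot hε))
      filter_upwards [eventually_le_atBot 0] with x hx
      exact add_le_add_left (hm hx) _
  exact ⟨(hs.orderIsoOfSurjective _ hsurj).toHomeomorph, fun x => rfl⟩

/-- The sign `σ` matches the direction of `μ`, so the added linear term reinforces its monotonicity.
-/
theorem exists_homeomorph_add_mul {μ : ℝ → ℝ} (hμ : Continuous μ)
    (hm : Monotone μ ∨ Antitone μ) :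
    ∃ σ : ℝ, ∀ ε, 0 < ε → ∃ e : ℝ ≃ₜ ℝ, ∀ x, e x = μ x + ε * (σ * x) := by
  rcases hm with hm | hm
  · exact ⟨1, fun ε hε => by simpa using exists_homeomorph_add_mul_of_monotone hμ hm hε⟩
  · refine ⟨-1, fun ε hε => ?_⟩
    obtain ⟨e, he⟩ := exists_homeomorph_add_mul_of_monotone hμ.neg hm.neg hε
    refine ⟨e.trans (Homeomorph.neg ℝ), fun x => ?_⟩
    simp only [Homeomorph.trans_apply, Homeomorph.coe_neg, he, Pi.neg_apply]
    ring

/-- `T + ε` fails to be invertible only when `ε` is one of the finitely many eigenvalues of `-T`. -/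
theorem eventually_exists_homeomorph_add_smul {V : Type*} [NormedAddCommGroup V] [NormedSpace ℝ V]
    [FiniteDimensional ℝ V] (T : V →ₗ[ℝ] V) :
    ∀ᶠ ε : ℝ in 𝓝[>] 0, ∃ e : V ≃ₜ V, ∀ x, e x = T x + ε • x := by
  have hfin : (spectrum ℝ (-T)).Finite := Module.End.finite_spectrum (-T)
  have h1 : ∀ᶠ ε : ℝ in 𝓝[>] 0, ε ∉ spectrum ℝ (-T) := by
    have h2 : ∀ᶠ ε : ℝ in 𝓝[≠] 0, ε ∉ spectrum ℝ (-T) := by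
      -- `0` is removed since it may itself be an eigenvalue.
      have h3 : (spectrum ℝ (-T) \ {0})ᶜ ∈ 𝓝 (0 : ℝ) :=
        (hfin.subset Set.sdiff_subset).isClosed.isOpen_compl.mem_nhds (by simp)
      filter_upwards [nhdsWithin_le_nhds h3, self_mem_nhdsWithin] with ε h4 h5 h6
      exact h4 ⟨h6, h5⟩
    exact h2.filter_mono (nhdsWithin_mono _ fun x hx => ne_of_gt hx)
  filter_upwards [h1] with ε hε
  have hu : IsUnit (algebraMap ℝ (Module.End ℝ V) ε - -T) := not_not.1 hε
  have hb := (Module.End.isUnit_iff _).1 hu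
  refine ⟨(LinearEquiv.ofBijective _ hb).toContinuousLinearEquiv.toHomeomorph, fun x => ?_⟩
  change (algebraMap ℝ (Module.End ℝ V) ε - -T) x = _
  simp [add_comm]

/-- The endomorphism of `ℝⁿ` given by a smaller matrix, padded with zeros. -/
def Matrix.padLin (n : ℕ) {a m : ℕ} (ha : a ≤ n) (W : Matrix (Fin m) (Fin a) ℝ) :
    (Fin n → ℝ) →ₗ[ℝ] (Fin n → ℝ) where
  toFun x i := if h : i.1 < m then W.mulVec (fun j => x (Fin.castLE ha j)) ⟨i, h⟩ else 0
  map_add' x y := by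
    ext i
    have : (fun j => (x + y) (Fin.castLE ha j)) =
      (fun j => x (Fin.castLE ha j)) + fun j => y (Fin.castLE ha j) := rfl
    rw [this, Matrix.mulVec_add]
    by_cases h : i.1 < m <;> simp [h]
  map_smul' c x := by
    ext i
    have : (fun j => (c • x) (Fin.castLE ha j)) = c • fun j => x (Fin.castLE ha j) := rfl
    rw [this, Matrix.mulVec_smul]
    by_cases h : i.1 < m <;> simp [h]

/-- The function `G` on `ℝ × ℝⁿ` is a continuous family whose members with small positive parameter
are homeomorphisms of `ℝⁿ`. -/
structure IsHomeoFamily {X : Type*} [TopologicalSpace X] (G : ℝ × X → X) : Prop where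
  continuous : Continuous G
  eventually_homeomorph : ∀ᶠ ε in 𝓝[>] (0 : ℝ), ∃ e : X ≃ₜ X, ∀ x, e x = G (ε, x)

theorem IsHomeoFamily.comp {X : Type*} [TopologicalSpace X] {G L : ℝ × X → X}
    (hG : IsHomeoFamily G) (hL : IsHomeoFamily L) :
    IsHomeoFamily fun z => G (z.1, L z) where
  continuous := hG.continuous.comp (continuous_fst.prodMk hL.continuous)
  eventually_homeomorph := by
    filter_upwards [hG.eventually_homeomorph, hL.eventually_homeomorph]
    rintro ε ⟨e, he⟩ ⟨l, hl⟩
    exact ⟨l.trans e, fun x => by simp [he, hl]⟩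

/-- The same `ε` perturbs the padded linear part and the activation; each factor is then a
homeomorphism, and at `ε = 0` the leading coordinates are the layer. -/
theorem exists_isHomeoFamily_layerMap {μ : ℝ → ℝ} (hμ : Continuous μ)
    (hm : Monotone μ ∨ Antitone μ) {n a m : ℕ} (ha : a ≤ n) (hmn : m ≤ n)
    (W : Matrix (Fin m) (Fin a) ℝ) (b : Fin m → ℝ) :
    ∃ L : ℝ × (Fin n → ℝ) → (Fin n → ℝ), IsHomeoFamily L ∧
      ∀ x i, L (0, x) (Fin.castLE hmn i) = layerMap μ W b (fun j => x (Fin.castLE ha j)) i := by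
  obtain ⟨σ, hσ⟩ := exists_homeomorph_add_mul hμ hm
  let T := W.padLin n ha
  have hT : Continuous T := T.continuous_of_finiteDimensional
  let c : Fin n → ℝ := fun i => if h : i.1 < m then b ⟨i, h⟩ else 0
  let y : ℝ × (Fin n → ℝ) → (Fin n → ℝ) := fun z => T z.2 + z.1 • z.2 + c
  have hy : Continuous y := by fun_prop
  refine ⟨fun z i => μ (y z i) + z.1 * (σ * y z i), ⟨by fun_prop, ?_⟩, fun x i => ?_⟩
  · filter_upwards [eventually_exists_homeomorph_add_smul T, self_mem_nhdsWithin]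
    rintro ε ⟨e, he⟩ hε
    obtain ⟨l, hl⟩ := hσ ε hε
    refine ⟨(e.trans (Homeomorph.addRight c)).trans (Homeomorph.piCongrRight fun _ => l),
      fun x => ?_⟩
    funext i
    simp [hl, he, y]
  · simp [y, c, T, Matrix.padLin, layerMap, coordwise]

theorem DNN.dom_le_width : ∀ {n m : ℕ} (N : DNN n m), n ≤ N.width
  | _, _, .last _ _ => le_rfl
  | _, _, .cons _ _ _ => le_max_left _ _

/-- A network of width at most `n` is, after padding, a limit of homeomorphisms of `ℝⁿ`. -/
theorem DNN.exists_isHomeoFamily {μ : ℝ → ℝ} (hμ : Continuous μ)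
    (hm : Monotone μ ∨ Antitone μ) {n a m : ℕ} (N : DNN a m) (hmn : m ≤ n) (hN : N.width ≤ n) :
    ∃ G : ℝ × (Fin n → ℝ) → (Fin n → ℝ), IsHomeoFamily G ∧
      ∀ x i, G (0, x) (Fin.castLE hmn i)
        = N.eval μ (fun j => x (Fin.castLE (N.dom_le_width.trans hN) j)) i := by
  induction N with
  | last W b => exact exists_isHomeoFamily_layerMap hμ hm hN hmn W b
  | cons W b N ih =>
    have hN' : N.width ≤ n := (le_max_right _ _).trans hN
    obtain ⟨G, hG, hG0⟩ := ih hmn hN'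
    obtain ⟨L, hL, hL0⟩ := exists_isHomeoFamily_layerMap hμ hm ((le_max_left _ _).trans hN)
      (N.dom_le_width.trans hN') W b
    refine ⟨_, hG.comp hL, fun x i => ?_⟩
    rw [hG0]
    simp only [hL0]
    rfl

/-! ### Level sets meet the sphere; the theorem -/

/-- The level set through `0` of a coordinate of a homeomorphism of `ℝⁿ`, `n > 1`, is connected and
unbounded, so it meets the unit sphere. -/
theorem Homeomorph.exists_norm_eq_one_apply_eq {n : ℕ} (hn : 1 < n)
    (e : (Fin n → ℝ) ≃ₜ (Fin n → ℝ)) (i : Fin n) :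
    ∃ x : EuclideanSpace ℝ (Fin n), ‖x‖ = 1 ∧ e x.ofLp i = e 0 i := by
  obtain ⟨j, hj⟩ : ∃ j, j ≠ i := by
    have : Nontrivial (Fin n) := Fin.nontrivial_iff_two_le.2 hn
    exact exists_ne i
  -- Preimage of a line through `e 0` in a direction `j ≠ i`: coordinate `i` of `e` is constant
  -- along it. This is where `n > 1` enters.
  let γ : ℝ → EuclideanSpace ℝ (Fin n) := fun s => WithLp.toLp 2 (e.symm (e 0 + Pi.single j s))
  have hγ : Continuous γ := by
    refine (PiLp.continuous_toLp 2 _).comp (e.symm.continuous.comp ?_)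
    exact continuous_const.add (continuous_single (A := fun _ : Fin n => ℝ) j)
  have heγ : ∀ s, e (γ s).ofLp = e 0 + Pi.single j s := fun s => by simp [γ]
  have hγ0 : ‖γ 0‖ = 0 := by simp [γ]
  have hcpt : IsCompact ((fun x : EuclideanSpace ℝ (Fin n) => e x.ofLp j) ''
      Metric.closedBall 0 1) := by
    refine (isCompact_closedBall _ _).image ?_
    exact (continuous_apply j).comp (e.continuous.comp (PiLp.continuous_ofLp 2 _))
  obtain ⟨C, hC⟩ := hcpt.bddAbove
  -- At this parameter coordinate `j` of `e` is `C + 1`, above its bound `C` on the ball.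
  have hbig : 1 ≤ ‖γ (C + 1 - e 0 j)‖ := by
    by_contra! hlt
    have := hC ⟨γ (C + 1 - e 0 j), by simpa using hlt.le, rfl⟩
    simp only [heγ, Pi.add_apply, Pi.single_eq_same] at this
    linarith
  obtain ⟨s, -, hs⟩ := intermediate_value_uIcc (a := (0 : ℝ)) hγ.norm.continuousOn
    (Set.mem_uIcc.2 (.inl ⟨by rw [hγ0]; exact zero_le_one, hbig⟩))
  refine ⟨γ s, hs, ?_⟩
  rw [heγ, Pi.add_apply, Pi.single_eq_of_ne hj.symm, add_zero]

/-- If the level set missed the sphere at parameter `0`, compactness of the sphere would make it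
miss for all small `ε`, including those giving homeomorphisms. -/
theorem IsHomeoFamily.exists_norm_eq_one_apply_eq {n : ℕ} (hn : 1 < n)
    {G : ℝ × (Fin n → ℝ) → (Fin n → ℝ)} (hG : IsHomeoFamily G) (i : Fin n) :
    ∃ x : EuclideanSpace ℝ (Fin n), ‖x‖ = 1 ∧ G (0, x.ofLp) i = G (0, 0) i := by
  by_contra! hne
  have hcont : Continuous fun z : ℝ × EuclideanSpace ℝ (Fin n) => G (z.1, z.2.ofLp) i :=
    (continuous_apply i).comp (hG.continuous.comp
      (continuous_fst.prodMk ((PiLp.continuous_ofLp 2 _).comp continuous_snd)))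
  have hcont0 : Continuous fun z : ℝ × EuclideanSpace ℝ (Fin n) => G (z.1, 0) i :=
    (continuous_apply i).comp (hG.continuous.comp (continuous_fst.prodMk continuous_const))
  have hev : ∀ᶠ ε : ℝ in 𝓝 0, ∀ x ∈ Metric.sphere (0 : EuclideanSpace ℝ (Fin n)) 1,
      G (ε, x.ofLp) i ≠ G (ε, 0) i := by
    refine (isCompact_sphere _ _).eventually_forall_of_forall_eventually fun x hx => ?_
    exact (hcont.continuousAt.ne_iff_eventually_ne hcont0.continuousAt).1
      (hne x (by simpa using hx))
  obtain ⟨ε, h1, e, he⟩ := ((hev.filter_mono nhdsWithin_le_nhds).and hG.eventually_homeomorph).exists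
  obtain ⟨x, hx, hxe⟩ := e.exists_norm_eq_one_apply_eq hn i
  rw [he, he] at hxe
  exact h1 x (by simpa using hx) hxe

/-- A network of width at most the input dimension `n > 1` takes its value at the centre of the
unit ball also on the unit sphere. -/
theorem DNN.exists_norm_eq_one_eval_eq {μ : ℝ → ℝ} (hμ : Continuous μ)
    (hm : Monotone μ ∨ Antitone μ) {n : ℕ} (hn : 1 < n) (N : DNN n 1) (hN : N.width ≤ n) :
    ∃ x : EuclideanSpace ℝ (Fin n), ‖x‖ = 1 ∧ N.eval μ x.ofLp 0 = N.eval μ 0 0 := by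
  obtain ⟨G, hG, hG0⟩ := N.exists_isHomeoFamily hμ hm hn.le hN
  obtain ⟨x, hx, hxG⟩ := hG.exists_norm_eq_one_apply_eq hn (Fin.castLE hn.le 0)
  rw [hG0, hG0] at hxG
  exact ⟨x, hx, hxG⟩

theorem theorem5p2 (n : ℕ) (hn : 1 < n) :
    (∀ δ : ℝ, 0 < δ → ∃ f : C(unitBall n, ℝ),
      ∀ μ : ℝ → ℝ, IsGroupHomotopicToHomeo μ →
        ∀ N : DNN n 1, N.width ≤ n →
          ∃ x : unitBall n, δ ≤ |N.onBall μ x - f x|) ∧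
    (∀ μ : ℝ → ℝ, IsGroupHomotopicToHomeo μ →
      ∀ w : ℕ, UniversalApproximation μ n w → n + 1 ≤ w) := by
  have main : ∀ δ : ℝ, 0 < δ → ∃ f : C(unitBall n, ℝ),
      ∀ μ : ℝ → ℝ, IsGroupHomotopicToHomeo μ →
        ∀ N : DNN n 1, N.width ≤ n →
          ∃ x : unitBall n, δ ≤ |N.onBall μ x - f x| := by
    intro δ hδ
    -- This function differs by `2 * δ` between centre and sphere, while the network repeats its
    -- central value on the sphere, so both errors cannot be below `δ`.
    refine ⟨⟨fun x => 2 * δ * ‖x.1‖, by fun_prop⟩, fun μ hμ N hN => ?_⟩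
    obtain ⟨x, hx, hxN⟩ :=
      N.exists_norm_eq_one_eval_eq hμ.continuous hμ.monotone_or_antitone hn hN
    by_contra! hlt
    have h0 := hlt ⟨0, by simp⟩
    have h1 := hlt ⟨x, by simp [hx]⟩
    simp only [DNN.onBall, ContinuousMap.coe_mk, norm_zero, hx, hxN, WithLp.ofLp_zero] at h0 h1
    rw [abs_lt] at h0 h1
    linarith [h0.2, h1.1]
  refine ⟨main, fun μ hμ w hw => ?_⟩
  by_contra! hlt
  obtain ⟨f, hf⟩ := main 1 one_pos
  obtain ⟨N, hN, hNf⟩ := hw f 1 one_pos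
  obtain ⟨x, hx⟩ := hf μ hμ N (by omega)
  exact not_lt.2 hx (hNf x)
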